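/- Conventions. A \emph{dcpo} is a partially ordered set in which every (nonempty) directed subset has a supremum; a least element is not required. A map between dcpos is \emph{continuous} if it is monotone and preserves suprema of directed subsets. For elements $x,y$ of a dcpo, $x\ll y$ means that every directed set $D$ with $y\le\sup D$ contains some $d$ with $x\le d$; a dcpo is \emph{continuous} if for each $x$ the set $\{y : y\ll x\}$ is directed with supremum $x$. For dcpos $X,Y$, $Y^X$ denotes the dcpo of continuous maps $X\to Y$, ordered pointwise. Let $\Omega$ be a finitary algebraic signature and $\mathcal E$ a set of equational laws $t_1=t_2$ and inequational laws $t_1\le t_2$ between $\Omega$-terms. A \emph{$\mathrm{Dcpo}_{\Omega,\mathcal E}$-algebra} is a dcpo $A$ with a continuous operation $\omega_A\colon A^n\to A$ for each $n$-ary $\omega\in\Omega$, such that all laws in $\mathcal E$ hold for every instantiation of the variables in $A$. For two such algebras, $\hom(A,B)$ is the dcpo of continuous $\Omega$-homomorphisms $A\to B$, ordered pointwise. A \emph{free $\mathrm{Dcpo}_{\Omega,\mathcal E}$-algebra} over a dcpo $X$ is a $\mathrm{Dcpo}_{\Omega,\mathcal E}$-algebra $F(X)$ with a continuous map $\iota_X\colon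 X\to F(X)$ such that for every $\mathrm{Dcpo}_{\Omega,\mathcal E}$-algebra $A$ and every continuous $f\colon X\to A$ there is a unique continuous $\Omega$-homomorphism $\widetilde f\colon F(X)\to A$ with $\widetilde f\circ\iota_X=f$. It is \emph{internally free} if for every $\mathrm{Dcpo}_{\Omega,\mathcal E}$-algebra $A$ the map $h\mapsto h\circ\iota_X$, $\hom(F(X),A)\to A^X$, is an isomorphism of dcpos. Proposition. For every continuous dcpo $X$, a free $\mathrm{Dcpo}_{\Omega,\mathcal E}$-algebra over $X$ exists, and every free $\mathrm{Dcpo}_{\Omega,\mathcal E}$-algebra $(F(X),\iota_X)$ over $X$ is internally free. That is, for every $\mathrm{Dcpo}_{\Omega,\mathcal E}$-algebra $A$, the extension operator $f\mapsto\widetilde f$ is an isomorphism of dcpos from $A^X$ to $\hom(F(X),A)$. -/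

import Mathlib

universe u v

/-- A partially ordered set is directed complete (a dcpo) if every (nonempty) directed subset
has a supremum. No least element is required. -/
class IsDcpo (α : Type u) [PartialOrder α] : Prop where
  exists_isLUB : ∀ d : Set α, d.Nonempty → DirectedOn (· ≤ ·) d → ∃ a, IsLUB d a

/-- `x` is way below `y`: whenever `y` is below the supremum of a directed set `d`,
some element of `d` is above `x`. -/
def DcpoWayBelow {α : Type u} [PartialOrder α] (x y : α) : Prop :=
  ∀ d : Set α, d.Nonempty → DirectedOn (· ≤ ·) d → ∀ s, IsLUB d s → y ≤ s → ∃ e ∈ d, x ≤ e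

/-- A continuous dcpo: a dcpo in which every element is the supremum of the elements way
below it, and these form a directed set. -/
class IsContinuousDcpo (α : Type u) [PartialOrder α] : Prop extends IsDcpo α where
  nonempty_wayBelow : ∀ x : α, {y : α | DcpoWayBelow y x}.Nonempty
  directedOn_wayBelow : ∀ x : α, DirectedOn (· ≤ ·) {y : α | DcpoWayBelow y x}
  isLUB_wayBelow : ∀ x : α, IsLUB {y : α | DcpoWayBelow y x} x

/-- The map `φ` is an isomorphism in the category of dcpos and Scott-continuous maps. -/
def IsDcpoIso {α : Type u} {β : Type v} [PartialOrder α] [PartialOrder β] [IsDcpo α] [IsDcpo β]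
    (φ : α → β) : Prop :=
  ScottContinuous φ ∧
    ∃ ψ : β → α, ScottContinuous ψ ∧ Function.LeftInverse ψ φ ∧ Function.RightInverse ψ φ

/-- The exponential `Y ^ X`: the Scott-continuous maps `X → Y`, ordered pointwise. -/
structure ScottExp (X : Type u) (Y : Type v) [PartialOrder X] [PartialOrder Y] :
    Type (max u v) where
  toFun : X → Y
  scottContinuous : ScottContinuous toFun

instance ScottExp.instFunLike (X : Type u) (Y : Type v) [PartialOrder X] [PartialOrder Y] :
    FunLike (ScottExp X Y) X Y where
  coe f := f.toFun
  coe_injective f g h := by cases f; cases g; congr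

instance ScottExp.instPartialOrder (X : Type u) (Y : Type v) [PartialOrder X] [PartialOrder Y] :
    PartialOrder (ScottExp X Y) :=
  PartialOrder.lift (fun f => (f : X → Y)) DFunLike.coe_injective

/-- The pointwise supremum of a directed set of Scott-continuous maps is Scott continuous. -/
theorem scottContinuous_of_pointwise_isLUB {X : Type u} {Y : Type v} [PartialOrder X]
    [PartialOrder Y] {D : Set (X → Y)} (hD : ∀ f ∈ D, ScottContinuous f) {g : X → Y}
    (hg : ∀ x, IsLUB ((fun f : X → Y => f x) '' D) (g x)) : ScottContinuous g := by
  intro d hne hdir a ha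
  constructor
  · rintro _ ⟨x, hx, rfl⟩
    refine (hg x).2 ?_
    rintro _ ⟨f, hf, rfl⟩
    exact ((hD f hf).monotone (ha.1 hx)).trans ((hg a).1 ⟨f, hf, rfl⟩)
  · intro b hb
    refine (hg a).2 ?_
    rintro _ ⟨f, hf, rfl⟩
    refine (hD f hf hne hdir ha).2 ?_
    rintro _ ⟨x, hx, rfl⟩
    exact ((hg x).1 ⟨f, hf, rfl⟩).trans (hb ⟨x, hx, rfl⟩)

/-- A directed set of maps into a dcpo has a pointwise supremum. -/
theorem exists_pointwise_isLUB {X : Type u} {Y : Type v} [PartialOrder Y] [IsDcpo Y]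
    {D : Set (X → Y)} (hne : D.Nonempty) (hdir : DirectedOn (· ≤ ·) D) :
    ∃ g : X → Y, ∀ x, IsLUB ((fun f : X → Y => f x) '' D) (g x) := by
  have h : ∀ x, ∃ a, IsLUB ((fun f : X → Y => f x) '' D) a := by
    intro x
    refine IsDcpo.exists_isLUB _ (hne.image _) ?_
    rintro _ ⟨f, hf, rfl⟩ _ ⟨f', hf', rfl⟩
    obtain ⟨k, hk, h1, h2⟩ := hdir f hf f' hf'
    exact ⟨k x, ⟨k, hk, rfl⟩, h1 x, h2 x⟩
  choose g hg using h
  exact ⟨g, hg⟩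

instance ScottExp.instIsDcpo (X : Type u) (Y : Type v) [PartialOrder X] [PartialOrder Y]
    [IsDcpo Y] : IsDcpo (ScottExp X Y) where
  exists_isLUB d hne hdir := by
    have hdir' : DirectedOn (· ≤ ·) ((fun f : ScottExp X Y => f.toFun) '' d) := by
      rintro _ ⟨f, hf, rfl⟩ _ ⟨f', hf', rfl⟩
      obtain ⟨k, hk, h1, h2⟩ := hdir f hf f' hf'
      exact ⟨k.toFun, ⟨k, hk, rfl⟩, h1, h2⟩
    obtain ⟨g, hg⟩ := exists_pointwise_isLUB (hne.image _) hdir'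
    have hgc : ScottContinuous g :=
      scottContinuous_of_pointwise_isLUB (by rintro _ ⟨f, _, rfl⟩; exact f.scottContinuous) hg
    refine ⟨⟨g, hgc⟩, fun f hf x => (hg x).1 ⟨f.toFun, ⟨f, hf, rfl⟩, rfl⟩, fun b hb x => ?_⟩
    refine (hg x).2 ?_
    rintro _ ⟨_, ⟨f, hf, rfl⟩, rfl⟩
    exact hb hf x

/-- A dcpo-algebra for the finitary algebraic signature `L` (a first-order language without
relation symbols): a dcpo with a Scott-continuous operation `A ^ n → A` for every operation
symbol of arity `n`. -/
structure DcpoAlgebra (L : FirstOrder.Language.{u, 0}) [L.IsAlgebraic] : Type (u + 1) where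
  /-- The underlying set. -/
  carrier : Type u
  [partialOrder : PartialOrder carrier]
  [isDcpo : IsDcpo carrier]
  [struct : L.Structure carrier]
  scottContinuous_funMap : ∀ (n : ℕ) (ω : L.Functions n),
    ScottContinuous (fun a : Fin n → carrier => FirstOrder.Language.Structure.funMap ω a)

namespace DcpoAlgebra

variable {L : FirstOrder.Language.{u, 0}} [L.IsAlgebraic]

instance : CoeSort (DcpoAlgebra L) (Type u) := ⟨DcpoAlgebra.carrier⟩

instance (A : DcpoAlgebra L) : PartialOrder A := A.partialOrder

instance (A : DcpoAlgebra L) : IsDcpo A := A.isDcpo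

instance (A : DcpoAlgebra L) : L.Structure A := A.struct

/-- The continuous homomorphisms from `A` to `B`, ordered pointwise. -/
structure Hom (A B : DcpoAlgebra L) : Type u where
  toFun : A → B
  scottContinuous : ScottContinuous toFun
  map_funMap : ∀ (n : ℕ) (ω : L.Functions n) (a : Fin n → A),
    toFun (FirstOrder.Language.Structure.funMap ω a) =
      FirstOrder.Language.Structure.funMap ω (fun i => toFun (a i))

instance Hom.instFunLike (A B : DcpoAlgebra L) : FunLike (Hom A B) A B where
  coe h := h.toFun
  coe_injective f g h := by cases f; cases g; congr

instance Hom.instPartialOrder (A B : DcpoAlgebra L) : PartialOrder (Hom A B) :=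
  PartialOrder.lift (fun h => (h : A → B)) DFunLike.coe_injective

instance Hom.instIsDcpo (A B : DcpoAlgebra L) : IsDcpo (Hom A B) where
  exists_isLUB d hne hdir := by
    have hdir' : DirectedOn (· ≤ ·) ((fun f : Hom A B => f.toFun) '' d) := by
      rintro _ ⟨f, hf, rfl⟩ _ ⟨f', hf', rfl⟩
      obtain ⟨k, hk, h1, h2⟩ := hdir f hf f' hf'
      exact ⟨k.toFun, ⟨k, hk, rfl⟩, h1, h2⟩
    obtain ⟨g, hg⟩ := exists_pointwise_isLUB (hne.image _) hdir'
    have hgc : ScottContinuous g :=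
      scottContinuous_of_pointwise_isLUB (by rintro _ ⟨f, _, rfl⟩; exact f.scottContinuous) hg
    have hgh : ∀ (n : ℕ) (ω : L.Functions n) (a : Fin n → A),
        g (FirstOrder.Language.Structure.funMap ω a) = FirstOrder.Language.Structure.funMap ω (fun i => g (a i)) := by
      intro n ω a
      -- the tuples `(f (a i))_i` for `f ∈ d` form a directed set with supremum `(g (a i))_i`
      have hT : IsLUB ((fun f : Hom A B => fun i => f.toFun (a i)) '' d) (fun i => g (a i)) := by
        refine ⟨?_, fun b hb i => (hg (a i)).2 ?_⟩
        · rintro _ ⟨f, hf, rfl⟩ i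
          exact (hg (a i)).1 ⟨f.toFun, ⟨f, hf, rfl⟩, rfl⟩
        · rintro _ ⟨_, ⟨f, hf, rfl⟩, rfl⟩
          exact hb ⟨f, hf, rfl⟩ i
      have hTd : DirectedOn (· ≤ ·) ((fun f : Hom A B => fun i => f.toFun (a i)) '' d) := by
        rintro _ ⟨f, hf, rfl⟩ _ ⟨f', hf', rfl⟩
        obtain ⟨k, hk, h1, h2⟩ := hdir f hf f' hf'
        exact ⟨_, ⟨k, hk, rfl⟩, fun i => h1 (a i), fun i => h2 (a i)⟩
      have h1 := B.scottContinuous_funMap n ω (hne.image _) hTd hT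
      have h2 := hg (FirstOrder.Language.Structure.funMap ω a)
      rw [Set.image_image] at h1
      rw [Set.image_image] at h2
      have h3 : (fun f : Hom A B => f.toFun (FirstOrder.Language.Structure.funMap ω a)) '' d =
          (fun f : Hom A B => FirstOrder.Language.Structure.funMap ω fun i => f.toFun (a i)) '' d :=
        Set.image_congr fun f _ => f.map_funMap n ω a
      rw [h3] at h2
      exact h2.unique h1
    refine ⟨⟨g, hgc, hgh⟩, fun f hf x => (hg x).1 ⟨f.toFun, ⟨f, hf, rfl⟩, rfl⟩, fun b hb x => ?_⟩
    refine (hg x).2 ?_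
    rintro _ ⟨_, ⟨f, hf, rfl⟩, rfl⟩
    exact hb hf x

/-- An equational law `t₁ = t₂` or an inequational law `t₁ ≤ t₂` between terms in countably many
variables. -/
inductive Law (L : FirstOrder.Language.{u, 0}) : Type u
  | eq (t₁ t₂ : L.Term ℕ) : Law L
  | le (t₁ t₂ : L.Term ℕ) : Law L

/-- The algebra `A` satisfies the law for every instantiation of the variables. -/
def SatisfiesLaw (A : DcpoAlgebra L) : Law L → Prop
  | .eq t₁ t₂ => ∀ a : ℕ → A, t₁.realize a = t₂.realize a
  | .le t₁ t₂ => ∀ a : ℕ → A, t₁.realize a ≤ t₂.realize a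

/-- The algebra `A` satisfies all the laws in `E`. -/
def Satisfies (A : DcpoAlgebra L) (E : Set (Law L)) : Prop :=
  ∀ e ∈ E, A.SatisfiesLaw e

variable {X : Type u} [PartialOrder X]

/-- `F` with the continuous map `ι : X → F` is a free algebra over `X` among the dcpo-algebras
satisfying the laws `E`: every continuous map from `X` to such an algebra `A` extends uniquely
along `ι` to a continuous homomorphism `F → A`. -/
structure IsFree (E : Set (Law L)) (F : DcpoAlgebra L) (ι : ScottExp X F) : Prop where
  satisfies : F.Satisfies E
  existsUnique_extension : ∀ A : DcpoAlgebra L, A.Satisfies E → ∀ f : ScottExp X A,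
    ∃! h : Hom F A, ∀ x, h (ι x) = f x

/-- The extension operator `f ↦ f̃` from `A ^ X` to the continuous homomorphisms `F → A`:
`f̃` is the unique continuous homomorphism extending `f` along `ι`. -/
noncomputable def IsFree.extend {E : Set (Law L)} {F : DcpoAlgebra L} {ι : ScottExp X F}
    (hF : IsFree E F ι) {A : DcpoAlgebra L} (hA : A.Satisfies E) (f : ScottExp X A) : Hom F A :=
  (hF.existsUnique_extension A hA f).choose

/-- The map `h ↦ h ∘ ι` from the continuous homomorphisms `F → A` to `A ^ X`. -/
def Hom.restrict {F : DcpoAlgebra L} (ι : ScottExp X F) (A : DcpoAlgebra L) (h : Hom F A) :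
    ScottExp X A :=
  ⟨fun x => h (ι x), ι.scottContinuous.comp h.scottContinuous⟩

/-- `F` is internally free over `X` (free in the dcpo-enriched sense): for every algebra `A`
satisfying `E`, the map `h ↦ h ∘ ι` from `hom(F, A)` to `A ^ X` is an isomorphism of dcpos. -/
def IsInternallyFree (E : Set (Law L)) (F : DcpoAlgebra L) (ι : ScottExp X F) : Prop :=
  F.Satisfies E ∧ ∀ A : DcpoAlgebra L, A.Satisfies E → IsDcpoIso (Hom.restrict ι A)

end DcpoAlgebra

/-! Existence is the product argument of the adjoint functor theorem, and its only real content is a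
size bound. In an algebra, the subalgebra generated by the image of `f : X → A` lies in the directed
closure of the values of terms over `X`, because continuity of the operations makes this closure a
subalgebra (`isSubalgebra_directedClosure`). A point of the closure is determined by the terms whose
values lie below it (`termsBelow_injOn`), so up to isomorphism the generated algebras form a family
indexed by a type in the universe of `X`. The subalgebra of their product generated by `X` is free.

For internal freeness, a free algebra is generated by its unit (`IsFree.gen_range_eq_univ`), and the
locus `f ≤ g` of two homomorphisms is a subalgebra (`Hom.isSubalgebra_le`). Hence an inequality on
generators holds everywhere: the restriction bijection reflects the order, and an order isomorphism
is continuous in both directions. -/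

/-! ### Scott continuity and embeddings with range closed under directed suprema -/

section ScottContinuity

variable {α β γ : Type*} [PartialOrder α] [PartialOrder β] [PartialOrder γ]

theorem OrderEmbedding.exists_isLUB_of_range_isLUB_closed [IsDcpo β] (j : α ↪o β)
    (hj : ∀ d ⊆ Set.range j, d.Nonempty → DirectedOn (· ≤ ·) d → ∀ b, IsLUB d b → b ∈ Set.range j)
    {d : Set α} (hne : d.Nonempty) (hd : DirectedOn (· ≤ ·) d) :
    ∃ a, IsLUB d a ∧ IsLUB (j '' d) (j a) := by
  have hd' : DirectedOn (· ≤ ·) (j '' d) := hd.mono_comp fun _ _ h => j.monotone h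
  obtain ⟨b, hb⟩ := IsDcpo.exists_isLUB _ (hne.image j) hd'
  obtain ⟨a, rfl⟩ := hj _ (Set.image_subset_range _ _) (hne.image j) hd' b hb
  exact ⟨a, IsLUB.of_image j.le_iff_le hb, hb⟩

theorem OrderEmbedding.scottContinuous_of_range_isLUB_closed [IsDcpo β] (j : α ↪o β)
    (hj : ∀ d ⊆ Set.range j, d.Nonempty → DirectedOn (· ≤ ·) d → ∀ b, IsLUB d b → b ∈ Set.range j) :
    ScottContinuous j := by
  intro d hne hd a ha
  obtain ⟨a', ha', hja'⟩ := j.exists_isLUB_of_range_isLUB_closed hj hne hd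
  rwa [ha.unique ha']

/-- Order embeddings reflect least upper bounds; `j` need not preserve them. -/
theorem ScottContinuous.of_orderEmbedding_comp (j : β ↪o γ) {g : α → β}
    (hg : ScottContinuous fun x => j (g x)) : ScottContinuous g := by
  intro d hne hd a ha
  refine IsLUB.of_image j.le_iff_le ?_
  rw [Set.image_image]
  exact hg hne hd ha

theorem ScottContinuous.pi {ι : Type*} {π : ι → Type*} [∀ i, PartialOrder (π i)]
    {f : α → ∀ i, π i} (hf : ∀ i, ScottContinuous fun x => f x i) : ScottContinuous f := by
  intro d hne hd a ha
  rw [isLUB_pi]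
  intro i
  rw [Set.image_image]
  exact hf i hne hd ha

theorem ScottContinuous.eval {ι : Type*} {π : ι → Type*} [∀ i, PartialOrder (π i)] (i : ι) :
    ScottContinuous fun x : (∀ i, π i) => x i :=
  fun _ _ _ _ ha => isLUB_pi.1 ha i

theorem ScottContinuous.const' (b : β) : ScottContinuous fun _ : α => b := by
  intro d hne _ a _
  rw [hne.image_const]
  exact isLUB_singleton

theorem ScottContinuous.update {ι : Type*} [DecidableEq ι] (f : ι → α) (i : ι) :
    ScottContinuous fun x : α => Function.update f i x := by
  refine ScottContinuous.pi fun k => ?_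
  by_cases h : k = i
  · subst h
    simp only [Function.update_self]
    exact ScottContinuous.id
  · simp only [Function.update_of_ne h]
    exact ScottContinuous.const' (f k)

theorem isDcpoIso_of_orderIso [IsDcpo α] [IsDcpo β] (e : α ≃o β) : IsDcpoIso e :=
  ⟨fun _ _ _ _ ha => e.isLUB_image'.2 ha, e.symm, fun _ _ _ _ ha => e.symm.isLUB_image'.2 ha,
    e.symm_apply_apply, e.apply_symm_apply⟩

instance Pi.instIsDcpo {ι : Type*} {π : ι → Type*} [∀ i, PartialOrder (π i)] [∀ i, IsDcpo (π i)] :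
    IsDcpo (∀ i, π i) where
  exists_isLUB d hne hd := by
    have h : ∀ i, ∃ a, IsLUB (Function.eval i '' d) a := fun i =>
      IsDcpo.exists_isLUB _ (hne.image _) (hd.mono_comp fun _ _ h => h i)
    choose a ha using h
    exact ⟨a, isLUB_pi.2 ha⟩

end ScottContinuity

/-! ### Homomorphisms, subalgebras, products and generation -/

namespace DcpoAlgebra

open FirstOrder.Language Structure

variable {L : FirstOrder.Language.{u, 0}} [L.IsAlgebraic] {A B C : DcpoAlgebra L}

namespace Hom

theorem realize_term (h : Hom A B) {V : Type*} (t : L.Term V) (v : V → A) :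
    h (t.realize v) = t.realize fun x => h (v x) := by
  induction t with
  | var x => rfl
  | func ω ts ih =>
    simp only [Term.realize_func]
    rw [← funext ih]
    exact h.map_funMap _ ω _

def comp (g : Hom B C) (h : Hom A B) : Hom A C where
  toFun x := g (h x)
  scottContinuous := h.scottContinuous.comp g.scottContinuous
  map_funMap n ω a :=
    (congrArg g.toFun (h.map_funMap n ω a)).trans (g.map_funMap n ω _)

def id (A : DcpoAlgebra L) : Hom A A where
  toFun x := x
  scottContinuous := ScottContinuous.id
  map_funMap _ _ _ := rfl

end Hom

/-- Homomorphisms commute with term evaluation, so laws pull back along a family that jointly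
reflects the order; this serves both subalgebras and products. -/
theorem Satisfies.of_family {E : Set (Law L)} {ι : Type*} {B : ι → DcpoAlgebra L}
    (hB : ∀ i, (B i).Satisfies E) (h : ∀ i, Hom A (B i))
    (hle : ∀ x y, (∀ i, h i x ≤ h i y) → x ≤ y) : A.Satisfies E := by
  intro e he
  cases e with
  | eq s t =>
    intro a
    have key : ∀ i, h i (s.realize a) = h i (t.realize a) := fun i => by
      rw [Hom.realize_term, Hom.realize_term]
      exact hB i _ he _
    exact le_antisymm (hle _ _ fun i => (key i).le) (hle _ _ fun i => (key i).ge)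
  | le s t =>
    intro a
    refine hle _ _ fun i => ?_
    rw [Hom.realize_term, Hom.realize_term]
    exact hB i _ he _

/-- A subset closed under the operations and under directed suprema. -/
structure IsSubalgebra (A : DcpoAlgebra L) (S : Set A) : Prop where
  funMap_mem : ∀ (n : ℕ) (ω : L.Functions n) (a : Fin n → A), (∀ i, a i ∈ S) → funMap ω a ∈ S
  isLUB_mem : ∀ d ⊆ S, d.Nonempty → DirectedOn (· ≤ ·) d → ∀ b, IsLUB d b → b ∈ S

/-- The algebra structure on a type that injects into an algebra with a subalgebra as range. -/
noncomputable def comap (A : DcpoAlgebra L) {C : Type u} (j : C → A) (hj : Function.Injective j)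
    (hS : A.IsSubalgebra (Set.range j)) : DcpoAlgebra L :=
  letI po : PartialOrder C := PartialOrder.lift j hj
  let e : C ↪o A := ⟨⟨j, hj⟩, Iff.rfl⟩
  letI str : L.Structure C :=
    { funMap := fun {n} ω a =>
        (hS.funMap_mem n ω (fun i => j (a i)) fun _ => Set.mem_range_self _).choose }
  have he : ∀ n (ω : L.Functions n) (a : Fin n → C), j (funMap ω a) = funMap ω fun i => j (a i) :=
    fun n ω a => (hS.funMap_mem n ω (fun i => j (a i)) fun _ => Set.mem_range_self _).choose_spec
  { carrier := C
    isDcpo := ⟨fun _ hne hd =>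
      let ⟨a, ha, _⟩ := e.exists_isLUB_of_range_isLUB_closed hS.isLUB_mem hne hd
      ⟨a, ha⟩⟩
    scottContinuous_funMap := fun n ω => by
      refine ScottContinuous.of_orderEmbedding_comp e ?_
      have hc : ScottContinuous fun (a : Fin n → C) i => j (a i) := ScottContinuous.pi fun i =>
        (ScottContinuous.eval i).comp (e.scottContinuous_of_range_isLUB_closed hS.isLUB_mem)
      exact (funext fun a => he n ω a : (fun a => e (funMap ω a)) = _) ▸
        hc.comp (A.scottContinuous_funMap n ω) }

section comap

variable {Y : Type u} (j : Y → A) (hj : Function.Injective j) (hS : A.IsSubalgebra (Set.range j))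

def comapEmbedding : A.comap j hj hS ↪o A := ⟨⟨j, hj⟩, Iff.rfl⟩

def comapHom : Hom (A.comap j hj hS) A where
  toFun := j
  scottContinuous :=
    (comapEmbedding j hj hS).scottContinuous_of_range_isLUB_closed hS.isLUB_mem
  map_funMap n ω a :=
    (hS.funMap_mem n ω (fun i => j (a i)) fun _ => Set.mem_range_self _).choose_spec

theorem scottContinuous_comap {X : Type*} [PartialOrder X] {g : X → A.comap j hj hS}
    (hg : ScottContinuous fun x => comapHom j hj hS (g x)) : ScottContinuous g :=
  ScottContinuous.of_orderEmbedding_comp (comapEmbedding j hj hS) hg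

/-- Since the range of `j` is closed under directed suprema, suprema computed in `A` and in the
pulled-back algebra agree. -/
theorem IsSubalgebra.image_comap {S : Set (A.comap j hj hS)}
    (h : (A.comap j hj hS).IsSubalgebra S) : A.IsSubalgebra (comapHom j hj hS '' S) where
  funMap_mem n ω a ha := by
    choose c hc hca using ha
    exact ⟨funMap ω c, h.funMap_mem n ω c hc,
      ((comapHom j hj hS).map_funMap n ω c).trans (congrArg (funMap ω) (funext hca))⟩
  isLUB_mem d hd hne hdir b hb := by
    have hdj : d ⊆ Set.range j := hd.trans (Set.image_subset_range _ _)
    obtain ⟨c, rfl⟩ := hS.isLUB_mem d hdj hne hdir b hb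
    have him : comapEmbedding j hj hS '' (j ⁻¹' d) = d := Set.image_preimage_eq_of_subset hdj
    refine ⟨c, h.isLUB_mem (j ⁻¹' d) ?_ ?_ ?_ c ?_, rfl⟩
    · intro x hx
      obtain ⟨y, hy, hyx⟩ := hd hx
      exact hj hyx ▸ hy
    · exact Set.Nonempty.of_image (him.symm ▸ hne)
    · rintro x hx y hy
      obtain ⟨z, hz, h1, h2⟩ := hdir _ hx _ hy
      obtain ⟨w, rfl⟩ := hdj hz
      exact ⟨w, hz, h1, h2⟩
    · exact IsLUB.of_image (comapEmbedding j hj hS).le_iff_le (him.symm ▸ hb)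

theorem Satisfies.comap {E : Set (Law L)} (hA : A.Satisfies E) : (A.comap j hj hS).Satisfies E :=
  Satisfies.of_family (ι := Unit) (fun _ => hA) (fun _ => comapHom j hj hS) fun _ _ h => h ()

end comap

/-- The product of a family of algebras. -/
abbrev pi {ι : Type u} (B : ι → DcpoAlgebra L) : DcpoAlgebra L :=
  letI str : L.Structure (∀ i, B i) :=
    { funMap := fun ω a i => funMap ω fun k => a k i }
  { carrier := ∀ i, B i
    scottContinuous_funMap := fun n ω => ScottContinuous.pi fun i =>
      ScottContinuous.comp (g := fun a : Fin n → B i => funMap ω a)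
        (ScottContinuous.pi fun k => ScottContinuous.comp (f := fun a : Fin n → ∀ i, B i => a k)
          (ScottContinuous.eval (π := fun _ : Fin n => ∀ i, B i) k)
          (ScottContinuous.eval (π := fun i => (B i : Type u)) i))
        ((B i).scottContinuous_funMap n ω) }

def proj {ι : Type u} (B : ι → DcpoAlgebra L) (i : ι) : Hom (pi B) (B i) where
  toFun x := x i
  scottContinuous := ScottContinuous.eval (π := fun i => (B i : Type u)) i
  map_funMap _ _ _ := rfl

theorem Satisfies.pi {E : Set (Law L)} {ι : Type u} {B : ι → DcpoAlgebra L}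
    (hB : ∀ i, (B i).Satisfies E) : (DcpoAlgebra.pi B).Satisfies E :=
  Satisfies.of_family hB (proj B) fun _ _ h i => h i

/-- Operations are monotone and both maps preserve directed suprema, so the inequality propagates
from generators. -/
theorem Hom.isSubalgebra_le (f g : Hom A B) : A.IsSubalgebra {x | f x ≤ g x} where
  funMap_mem n ω a ha := by
    have hm := (B.scottContinuous_funMap n ω).monotone (a := fun i => f (a i))
      (b := fun i => g (a i)) ha
    exact (f.map_funMap n ω a).trans_le (hm.trans_eq (g.map_funMap n ω a).symm)
  isLUB_mem d hdS hne hd b hb := by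
    refine (f.scottContinuous hne hd hb).2 ?_
    rintro _ ⟨x, hx, rfl⟩
    exact (hdS hx).trans (g.scottContinuous.monotone (hb.1 hx))

/-- The least subalgebra that contains a given set. -/
def gen (A : DcpoAlgebra L) (T : Set A) : Set A :=
  ⋂₀ {S | A.IsSubalgebra S ∧ T ⊆ S}

theorem subset_gen (T : Set A) : T ⊆ A.gen T := fun _ hx _ hS => hS.2 hx

theorem gen_subset {T S : Set A} (hS : A.IsSubalgebra S) (hT : T ⊆ S) : A.gen T ⊆ S :=
  fun _ hx => hx S ⟨hS, hT⟩

theorem isSubalgebra_gen (T : Set A) : A.IsSubalgebra (A.gen T) where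
  funMap_mem n ω a ha S hS := hS.1.funMap_mem n ω a fun i => ha i S hS
  isLUB_mem d hd hne hdir b hb S hS :=
    hS.1.isLUB_mem d (fun _ hx => hd hx S hS) hne hdir b hb

theorem gen_comap_eq_univ {Y : Type u} (j : Y → A) (hj : Function.Injective j)
    (hS : A.IsSubalgebra (Set.range j)) {T : Set (A.comap j hj hS)}
    (hT : Set.range j ⊆ A.gen (comapHom j hj hS '' T)) :
    (A.comap j hj hS).gen T = Set.univ := by
  refine Set.eq_univ_of_forall fun x => ?_
  obtain ⟨y, hy, hyx⟩ := gen_subset (IsSubalgebra.image_comap j hj hS (isSubalgebra_gen T))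
    (Set.image_mono (subset_gen T)) (hT ⟨x, rfl⟩)
  exact hj hyx ▸ hy

theorem Hom.le_on_gen {T : Set A} {f g : Hom A B} (h : ∀ x ∈ T, f x ≤ g x) {x : A}
    (hx : x ∈ A.gen T) : f x ≤ g x :=
  gen_subset (f.isSubalgebra_le g) h hx

theorem Hom.ext_of_gen_eq_univ {T : Set A} (hT : A.gen T = Set.univ) {f g : Hom A B}
    (h : ∀ x ∈ T, f x = g x) : f = g :=
  DFunLike.ext _ _ fun x =>
    have hx : x ∈ A.gen T := hT ▸ Set.mem_univ x
    le_antisymm (Hom.le_on_gen (fun y hy => (h y hy).le) hx)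
      (Hom.le_on_gen (fun y hy => (h y hy).ge) hx)

end DcpoAlgebra

/-! ### Closure under directed suprema -/

section DirectedClosure

variable {α : Type*} [PartialOrder α]

def IsDirectedClosed (S : Set α) : Prop :=
  ∀ d ⊆ S, d.Nonempty → DirectedOn (· ≤ ·) d → ∀ b, IsLUB d b → b ∈ S

/-- The least subset that contains `T` and is closed under directed suprema. -/
def directedClosure (T : Set α) : Set α :=
  ⋂₀ {S | IsDirectedClosed S ∧ T ⊆ S}

theorem subset_directedClosure (T : Set α) : T ⊆ directedClosure T := fun _ hx _ hS => hS.2 hx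

theorem directedClosure_subset {T S : Set α} (hS : IsDirectedClosed S) (hT : T ⊆ S) :
    directedClosure T ⊆ S :=
  fun _ hx => hx S ⟨hS, hT⟩

theorem isDirectedClosed_directedClosure (T : Set α) : IsDirectedClosed (directedClosure T) :=
  fun d hd hne hdir b hb S hS => hS.1 d (fun _ hx => hd hx S hS) hne hdir b hb

theorem IsDirectedClosed.preimage {β : Type*} [PartialOrder β] {S : Set β}
    (hS : IsDirectedClosed S) {f : α → β} (hf : ScottContinuous f) :
    IsDirectedClosed (f ⁻¹' S) := by
  intro d hd hne hdir b hb
  refine hS (f '' d) (Set.image_subset_iff.2 hd) (hne.image f) ?_ _ (hf hne hdir hb)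
  exact hdir.mono_comp fun _ _ h => hf.monotone h

/-- Points of the directed closure of `T` are compared by the elements of `T` below them. -/
theorem le_of_mem_directedClosure {T : Set α} {b c : α} (hb : b ∈ directedClosure T)
    (h : ∀ t ∈ T, t ≤ b → t ≤ c) : b ≤ c := by
  -- The premise `x ≤ b` is inherited by every element below `x`, which makes this set closed under
  -- directed suprema.
  have key : directedClosure T ⊆ {x | x ≤ b → x ≤ c} := by
    refine directedClosure_subset ?_ h
    intro d hd _ _ s hs hsb
    exact hs.2 fun x hx => hd hx ((hs.1 hx).trans hsb)
  exact key hb le_rfl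

end DirectedClosure

/-! ### The size bound and existence of free algebras -/

namespace DcpoAlgebra

open FirstOrder.Language Structure

variable {L : FirstOrder.Language.{u, 0}} [L.IsAlgebraic] {A B C : DcpoAlgebra L}

/-- Operations are continuous in each argument separately, so arguments can be moved from `T` into
its closure one coordinate at a time; `s` is the set of coordinates already moved. -/
theorem isSubalgebra_directedClosure {T : Set A}
    (hT : ∀ (n : ℕ) (ω : L.Functions n) (a : Fin n → A), (∀ i, a i ∈ T) → funMap ω a ∈ T) :
    A.IsSubalgebra (directedClosure T) where
  isLUB_mem := isDirectedClosed_directedClosure T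
  funMap_mem n ω := by
    have key : ∀ (s : Finset (Fin n)) (a : Fin n → A), (∀ i ∈ s, a i ∈ directedClosure T) →
        (∀ i ∉ s, a i ∈ T) → funMap ω a ∈ directedClosure T := by
      intro s
      induction s using Finset.induction_on with
      | empty => exact fun a _ ha => subset_directedClosure T (hT n ω a fun i => ha i (by simp))
      | insert j s hj ih =>
        intro a h1 h2
        have hsub : directedClosure T ⊆
            (fun x => funMap ω (Function.update a j x)) ⁻¹' directedClosure T := by
          refine directedClosure_subset ((isDirectedClosed_directedClosure T).preimage
            ((ScottContinuous.update a j).comp (A.scottContinuous_funMap n ω))) fun x hx => ?_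
          refine ih _ (fun i hi => ?_) fun i hi => ?_
          · rw [Function.update_of_ne (fun hij : i = j => hj (hij ▸ hi))]
            exact h1 i (Finset.mem_insert_of_mem hi)
          · by_cases hij : i = j
            · subst hij
              simpa using hx
            · rw [Function.update_of_ne hij]
              exact h2 i (by simp [hij, hi])
        simpa using hsub (h1 j (Finset.mem_insert_self j s))
    exact fun a ha => key Finset.univ a (fun i _ => ha i) fun i hi => (hi (Finset.mem_univ i)).elim

theorem gen_range_subset_directedClosure {X : Type*} (f : X → A) :
    A.gen (Set.range f) ⊆ directedClosure (Set.range fun t : L.Term X => t.realize f) := by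
  refine gen_subset (isSubalgebra_directedClosure fun n ω a ha => ?_) ?_
  · choose t ht using ha
    exact ⟨Term.func ω t, congrArg (funMap ω) (funext ht)⟩
  · rintro _ ⟨x, rfl⟩
    exact subset_directedClosure _ ⟨Term.var x, rfl⟩

/-- The terms whose value under `f` lies below `b`. -/
def termsBelow {X : Type*} (f : X → A) (b : A) : Set (L.Term X) := {t | t.realize f ≤ b}

theorem termsBelow_injOn {X : Type*} (f : X → A) :
    Set.InjOn (termsBelow f) (A.gen (Set.range f)) := by
  have key : ∀ b ∈ A.gen (Set.range f), ∀ c, termsBelow f b = termsBelow f c → b ≤ c := by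
    intro b hb c h
    refine le_of_mem_directedClosure (gen_range_subset_directedClosure f hb) ?_
    rintro _ ⟨t, rfl⟩ ht
    exact (h ▸ ht : t ∈ termsBelow f c)
  exact fun b hb c hc h => le_antisymm (key b hb c h) (key c hc b h.symm)

variable {X : Type u} [PartialOrder X]

/-- A set of sets of terms as a bare type, without the order by inclusion. -/
def TermSets {X : Type u} (s : Set (Set (L.Term X))) : Type u := s

/-- The algebras under `X` whose elements are sets of terms: up to isomorphism, these include all
algebras generated by a continuous image of `X`. -/
structure SmallAlgebra (E : Set (Law L)) (X : Type u) [PartialOrder X] :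
    Type u where
  terms : Set (Set (L.Term X))
  [partialOrder : PartialOrder (TermSets terms)]
  [struct : L.Structure (TermSets terms)]
  isDcpo : IsDcpo (TermSets terms)
  scottContinuous_funMap : ∀ (n : ℕ) (ω : L.Functions n),
    ScottContinuous (fun a : Fin n → TermSets terms => funMap ω a)
  unit : X → TermSets terms
  scottContinuous_unit : ScottContinuous unit
  satisfies : ({ carrier := TermSets terms, scottContinuous_funMap } : DcpoAlgebra L).Satisfies E

def SmallAlgebra.toDcpoAlgebra {E : Set (Law L)} (S : SmallAlgebra E X) : DcpoAlgebra L :=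
  letI := S.partialOrder
  letI := S.struct
  letI := S.isDcpo
  { carrier := TermSets S.terms, scottContinuous_funMap := S.scottContinuous_funMap }

/-- The solution set condition: `termsBelow f` relabels the subalgebra generated by `f` by sets of
terms, and the structure is transported from `A`. -/
theorem exists_smallAlgebra_hom {E : Set (Law L)} (hA : A.Satisfies E) (f : ScottExp X A) :
    ∃ (S : SmallAlgebra E X) (h : Hom S.toDcpoAlgebra A), ∀ x, h (S.unit x) = f x := by
  set G := A.gen (Set.range f)
  have hinj : Set.InjOn (termsBelow f) G := termsBelow_injOn f
  let e : G ≃ TermSets (termsBelow f '' G) := Equiv.Set.imageOfInjOn _ _ hinj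
  let j : TermSets (termsBelow f '' G) → A := fun c => e.symm c
  have hj : Function.Injective j := Subtype.val_injective.comp e.symm.injective
  have hr : Set.range j = G := by
    rw [show j = Subtype.val ∘ e.symm from rfl, e.symm.surjective.range_comp]
    exact Subtype.range_coe
  have hS : A.IsSubalgebra (Set.range j) := by
    rw [hr]
    exact isSubalgebra_gen _
  let g : X → TermSets (termsBelow f '' G) := fun x => e ⟨f x, subset_gen _ ⟨x, rfl⟩⟩
  have hg : ∀ x, j (g x) = f x := fun x => by simp [j, g]
  let A' := A.comap j hj hS
  refine ⟨{ terms := termsBelow f '' G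
            partialOrder := A'.partialOrder
            struct := A'.struct
            isDcpo := A'.isDcpo
            scottContinuous_funMap := A'.scottContinuous_funMap
            unit := g
            scottContinuous_unit := ?_
            satisfies := hA.comap j hj hS }, comapHom j hj hS, hg⟩
  refine scottContinuous_comap j hj hS (g := g) ?_
  exact (funext hg : (fun x => comapHom j hj hS (g x)) = f.toFun) ▸ f.scottContinuous

theorem exists_isFree (E : Set (Law L)) (X : Type u) [PartialOrder X] :
    ∃ (F : DcpoAlgebra L) (ι : ScottExp X F), IsFree E F ι := by
  let P := pi fun S : SmallAlgebra E X => S.toDcpoAlgebra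
  let η : X → P := fun x S => S.unit x
  have hη : ScottContinuous η := ScottContinuous.pi
    (π := fun S : SmallAlgebra E X => (S.toDcpoAlgebra : Type u)) fun S => S.scottContinuous_unit
  let j : P.gen (Set.range η) → P := Subtype.val
  have hj : Function.Injective j := Subtype.val_injective
  have hS : P.IsSubalgebra (Set.range j) := by
    rw [Subtype.range_coe]
    exact isSubalgebra_gen _
  let ι : ScottExp X (P.comap j hj hS) :=
    ⟨fun x => (⟨η x, subset_gen _ ⟨x, rfl⟩⟩ : P.gen (Set.range η)), scottContinuous_comap j hj hS hη⟩
  refine ⟨P.comap j hj hS, ι, ?_, fun A hA f => ?_⟩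
  · exact Satisfies.comap j hj hS (Satisfies.pi fun S => S.satisfies)
  · obtain ⟨S, h, hh⟩ := exists_smallAlgebra_hom hA f
    refine ⟨(h.comp (proj _ S)).comp (comapHom j hj hS), hh, fun k hk => ?_⟩
    have hgen : (P.comap j hj hS).gen (Set.range ι) = Set.univ := by
      refine gen_comap_eq_univ j hj hS ?_
      rw [← Set.range_comp, Subtype.range_coe]
      exact subset_rfl
    refine Hom.ext_of_gen_eq_univ hgen ?_
    rintro _ ⟨x, rfl⟩
    exact (hk x).trans (hh x).symm

/-! ### Generation by the unit and internal freeness -/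

namespace IsFree

variable {E : Set (Law L)} {F : DcpoAlgebra L} {ι : ScottExp X F}

/-- Extend the unit, corestricted to the generated subalgebra, to `r`. The inclusion after `r` fixes
the unit, so it is the identity by uniqueness, and the inclusion is onto. -/
theorem gen_range_eq_univ (hF : IsFree E F ι) : F.gen (Set.range ι) = Set.univ := by
  let j : F.gen (Set.range ι) → F := Subtype.val
  have hj : Function.Injective j := Subtype.val_injective
  have hS : F.IsSubalgebra (Set.range j) := by
    rw [Subtype.range_coe]
    exact isSubalgebra_gen _
  let i : ScottExp X (F.comap j hj hS) :=
    ⟨fun x => (⟨ι x, subset_gen _ ⟨x, rfl⟩⟩ : F.gen (Set.range ι)),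
      scottContinuous_comap j hj hS ι.scottContinuous⟩
  obtain ⟨r, hr, -⟩ := hF.existsUnique_extension _ (hF.satisfies.comap j hj hS) i
  have h : (comapHom j hj hS).comp r = Hom.id F :=
    (hF.existsUnique_extension F hF.satisfies ι).unique
      (fun x => congrArg (comapHom j hj hS) (hr x)) fun _ => rfl
  refine Set.eq_univ_of_forall fun x => ?_
  have hx : j (r x) = x := DFunLike.congr_fun h x
  exact hx ▸ (r x : F.gen (Set.range ι)).2

theorem extend_apply (hF : IsFree E F ι) (hA : A.Satisfies E) (f : ScottExp X A) (x : X) :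
    hF.extend hA f (ι x) = f x :=
  (hF.existsUnique_extension A hA f).choose_spec.1 x

theorem extend_restrict (hF : IsFree E F ι) (hA : A.Satisfies E) (h : Hom F A) :
    hF.extend hA (h.restrict ι A) = h :=
  (hF.existsUnique_extension A hA _).unique (hF.extend_apply hA _) fun _ => rfl

theorem restrict_extend (hF : IsFree E F ι) (hA : A.Satisfies E) (f : ScottExp X A) :
    (hF.extend hA f).restrict ι A = f :=
  DFunLike.ext _ _ (hF.extend_apply hA f)

/-- Restriction along the unit of a free algebra, as an order isomorphism. -/
noncomputable def restrictOrderIso (hF : IsFree E F ι) (hA : A.Satisfies E) :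
    Hom F A ≃o ScottExp X A where
  toFun := Hom.restrict ι A
  invFun := hF.extend hA
  left_inv := hF.extend_restrict hA
  right_inv := hF.restrict_extend hA
  map_rel_iff' := by
    intro f g
    refine ⟨fun h x => ?_, fun h x => h (ι x)⟩
    refine Hom.le_on_gen (T := Set.range ι) ?_ (hF.gen_range_eq_univ ▸ Set.mem_univ x)
    rintro _ ⟨y, rfl⟩
    exact h y

theorem isDcpoIso_restrict (hF : IsFree E F ι) (hA : A.Satisfies E) :
    IsDcpoIso (Hom.restrict ι A) :=
  isDcpoIso_of_orderIso (hF.restrictOrderIso hA)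

theorem isDcpoIso_extend (hF : IsFree E F ι) (hA : A.Satisfies E) :
    IsDcpoIso fun f : ScottExp X A => hF.extend hA f :=
  isDcpoIso_of_orderIso (hF.restrictOrderIso hA).symm

end IsFree

end DcpoAlgebra

theorem mainTheorem12 (L : FirstOrder.Language.{u, 0}) [L.IsAlgebraic]
    (E : Set (DcpoAlgebra.Law L)) (X : Type u) [PartialOrder X] [IsContinuousDcpo X] :
    (∃ (F : DcpoAlgebra L) (ι : ScottExp X F), DcpoAlgebra.IsFree E F ι) ∧
    ∀ (F : DcpoAlgebra L) (ι : ScottExp X F) (hF : DcpoAlgebra.IsFree E F ι),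
      DcpoAlgebra.IsInternallyFree E F ι ∧
      ∀ (A : DcpoAlgebra L) (hA : A.Satisfies E),
        IsDcpoIso (fun f : ScottExp X A => hF.extend hA f) := by
  exact ⟨DcpoAlgebra.exists_isFree E X, fun F ι hF =>
    ⟨⟨hF.satisfies, fun A hA => hF.isDcpoIso_restrict hA⟩,
    fun A hA => hF.isDcpoIso_extend hA⟩⟩
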